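/- Let $X$ be a (real or complex) Banach space with a Schauder basis $(e_n)_{n\ge 1}$ and let $\alpha<\omega_1$. For $x=\sum_n x_ne_n$ put $\operatorname{supp}x=\{n: x_n\neq 0\}$, and write $x<y$ if $\max\operatorname{supp}x<\min\operatorname{supp}y$. A (finite or infinite) sequence $(x_i)$ is a block sequence if $x_1<x_2<\dots$, and it is normalized if $\|x_i\|=1$ for all $i$. A finite sequence $(x_1,\dots,x_k)$ is $K$-equivalent to the unit vector basis of $\ell_1^k$ ($K\ge 1$) if $K\|\sum_i a_ix_i\|\ge\sum_i|a_i|$ for all scalars $a_1,\dots,a_k$. A tree on a set $S$ is a set $\mathcal T$ of nonempty finite sequences in $S$ such that $(x_1,\dots,x_k)\in\mathcal T$ whenever $k\ge1$ and $(x_1,\dots,x_{k+1})\in\mathcal T$. It is well-founded if there is no infinite sequence all of whose nonempty initial segments belong to $\mathcal T$. Let $D(\mathcal T)=\{(x_1,\dots,x_k): k\ge 1,\ (x_1,\dots,x_k,x)\in\mathcal T\text{ for some }x\in S\}$, $D^0(\mathcal T)=\mathcal T$, $D^{\xi+1}(\mathcal T)=D(D^\xi(\mathcal T))$ and $D^\xi(\mathcal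 T)=\bigcap_{\eta<\xi}D^\eta(\mathcal T)$ for limit $\xi$. The order of a well-founded tree is $o(\mathcal T)=\min\{\xi: D^\xi(\mathcal T)=\emptyset\}$. An $\ell_1$-$K$-block tree on $X$ is a tree on $X$ each of whose elements is a normalized block sequence $K$-equivalent to the unit vector basis of the $\ell_1$-space of the same dimension. Let $I_b(X,K)$ be the supremum of $o(\mathcal T)$ over all well-founded $\ell_1$-$K$-block trees $\mathcal T$ on $X$, and let $I_b(X)=\sup_{K\ge1}I_b(X,K)$ (the Bourgain $\ell_1$-block index). The generalized Schreier families $\mathcal S_\xi$, $\xi<\omega_1$, of finite subsets of $\mathbb N=\{1,2,\dots\}$ are: $\mathcal S_0=\{\{n\}:n\in\mathbb N\}\cup\{\emptyset\}$; $\mathcal S_{\xi+1}=\{F_1\cup\dots\cup F_m: m\in\mathbb N,\ F_1,\dots,F_m\in\mathcal S_\xi,\ m\le F_1<\dots<F_m\}$; and for limit $\xi$, $\mathcal S_\xi=\{F: F\in\mathcal S_{\xi_n}\text{ and }n\le F\text{ for some }n\in\mathbb N\}$, where $(\xi_n)_{n\ge 1}$ is a strictly increasing sequence with supremum $\xi$,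 chosen arbitrarily, once and for all, for each limit $\xi<\omega_1$. (1) Suppose that $X$ admits an $\ell_1^\alpha$-spreading model, i.e. there are $C\ge1$ and an infinite normalized block sequence $(x_i)_{i\ge 1}$ in $X$ such that for every $F\in\mathcal S_\alpha$ the sequence $(x_i)_{i\in F}$ is $C$-equivalent to the unit vector basis of the $\# F$-dimensional $\ell_1$. Then $I_b(X)>\omega^\alpha$. (2) Suppose that $X$ is $\ell_1^\alpha$-asymptotic, i.e. there is $C\ge1$ such that every normalized finite sequence $x_1<\dots<x_k$ in $X$ with $\{\min\operatorname{supp}x_1,\dots,\min\operatorname{supp}x_k\}\in\mathcal S_\alpha$ is $C$-equivalent to the unit vector basis of $\ell_1^k$. Then $I_b(X)\ge\omega^{\alpha\cdot\omega}$. -/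

import Mathlib

open scoped Ordinal

universe u v

noncomputable section

namespace BlockIndex

/-! ### Trees and their order -/

section Trees

variable {S : Type u}

/-- A tree on `S`: a set of nonempty finite sequences `(x₁, …, xₖ)` closed under removing
the last term (as long as something is left). -/
def IsTree (T : Set (List S)) : Prop :=
  [] ∉ T ∧ ∀ l : List S, l ≠ [] → ∀ x : S, l ++ [x] ∈ T → l ∈ T

/-- There is no infinite sequence all of whose nonempty initial segments are in `T`. -/
def IsWellFoundedTree (T : Set (List S)) : Prop :=
  ¬ ∃ f : ℕ → S, ∀ k : ℕ, List.ofFn (fun i : Fin (k + 1) => f i) ∈ T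

/-- `D(T)`: the nonempty sequences having a one-term extension in `T`. -/
def derive (T : Set (List S)) : Set (List S) :=
  {l | l ≠ [] ∧ ∃ x : S, l ++ [x] ∈ T}

/-- The iterated derivatives `D^α(T)`, with intersections at limit ordinals. -/
def iterDerive (T : Set (List S)) (α : Ordinal.{u}) : Set (List S) :=
  Ordinal.limitRecOn α T (fun _ D => derive D) (fun β _ D => ⋂ (ξ : Ordinal.{u}) (h : ξ < β), D ξ h)

theorem iterDerive_zero (T : Set (List S)) : iterDerive T 0 = T := by
  simp [iterDerive]

theorem iterDerive_succ (T : Set (List S)) (α : Ordinal.{u}) :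
    iterDerive T (α + 1) = derive (iterDerive T α) := by
  simp [iterDerive]

theorem iterDerive_limit (T : Set (List S)) {α : Ordinal.{u}} (h : Order.IsSuccLimit α) :
    iterDerive T α = ⋂ (ξ : Ordinal.{u}) (_ : ξ < α), iterDerive T ξ := by
  rw [iterDerive, Ordinal.limitRecOn_limit _ _ _ _ h]
  rfl

/-- The order `o(T)` of a (well-founded) tree: the least `α` with `D^α(T) = ∅`. -/
def order (T : Set (List S)) : Ordinal.{u} :=
  sInf {α : Ordinal.{u} | iterDerive T α = ∅}

end Trees

/-! ### Generalized Schreier families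

The natural numbers start at `1`, so the index set is `ℕ+`. -/

/-- A choice, for each countable limit ordinal `α`, of a strictly increasing sequence
`(c α n)` with supremum `α`. -/
def IsLadder (c : Ordinal.{u} → ℕ+ → Ordinal.{u}) : Prop :=
  ∀ α : Ordinal.{u}, Order.IsSuccLimit α → α < ω₁ →
    StrictMono (c α) ∧ IsLUB (Set.range (c α)) α

/-- The successor step: all unions `F₁ ∪ … ∪ Fₘ` with `Fᵢ ∈ 𝓕` and `m ≤ F₁ < … < Fₘ`
(some of the `Fᵢ` may be empty). -/
def schreierStep (𝓕 : Set (Finset ℕ+)) : Set (Finset ℕ+) :=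
  {F | ∃ (m : ℕ+) (G : Fin m → Finset ℕ+), (∀ i, G i ∈ 𝓕) ∧
    (∀ i, ∀ k ∈ G i, m ≤ k) ∧ (∀ i j, i < j → ∀ a ∈ G i, ∀ b ∈ G j, a < b) ∧
    F = Finset.univ.biUnion G}

/-- The generalized Schreier family `𝓢_α` built from the choice `c` of approximating sequences. -/
def schreier (c : Ordinal.{u} → ℕ+ → Ordinal.{u}) (α : Ordinal.{u}) : Set (Finset ℕ+) :=
  Ordinal.limitRecOn α ({∅} ∪ {F | ∃ n : ℕ+, F = {n}}) (fun _ 𝓕 => schreierStep 𝓕)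
    (fun β _ 𝓕 => {F | ∃ (n : ℕ+) (h : c β n < β), F ∈ 𝓕 (c β n) h ∧ ∀ k ∈ F, n ≤ k})

theorem schreier_zero (c : Ordinal.{u} → ℕ+ → Ordinal.{u}) :
    schreier c 0 = {∅} ∪ {F | ∃ n : ℕ+, F = {n}} := by
  simp [schreier]

theorem schreier_succ (c : Ordinal.{u} → ℕ+ → Ordinal.{u}) (α : Ordinal.{u}) :
    schreier c (α + 1) = schreierStep (schreier c α) := by
  simp [schreier]

theorem IsLadder.lt {c : Ordinal.{u} → ℕ+ → Ordinal.{u}} (hc : IsLadder c) {α : Ordinal.{u}}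
    (h : Order.IsSuccLimit α) (hα : α < ω₁) (n : ℕ+) : c α n < α :=
  lt_of_lt_of_le ((hc α h hα).1 (PNat.lt_add_right n 1)) ((hc α h hα).2.1 ⟨n + 1, rfl⟩)

theorem schreier_limit {c : Ordinal.{u} → ℕ+ → Ordinal.{u}} (hc : IsLadder c) {α : Ordinal.{u}}
    (h : Order.IsSuccLimit α) (hα : α < ω₁) :
    schreier c α = {F | ∃ n : ℕ+, F ∈ schreier c (c α n) ∧ ∀ k ∈ F, n ≤ k} := by
  rw [schreier, Ordinal.limitRecOn_limit _ _ _ _ h]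
  ext F
  constructor
  · rintro ⟨n, _, h1, h2⟩
    exact ⟨n, h1, h2⟩
  · rintro ⟨n, h1, h2⟩
    exact ⟨n, hc.lt h hα n, h1, h2⟩

/-- A finite sequence `E₁ < E₂ < …` of (nonempty) sets with `{min E₁, min E₂, …} ∈ 𝓕`. -/
def IsAdmissible (𝓕 : Set (Finset ℕ+)) {k : ℕ} (E : Fin k → Set ℕ+) : Prop :=
  (∀ i j, i < j → ∀ a ∈ E i, ∀ b ∈ E j, a < b) ∧
    ∃ n : Fin k → ℕ+, (∀ i, IsLeast (E i) (n i)) ∧ Finset.univ.image n ∈ 𝓕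

/-! ### Banach spaces with a basis -/

section Banach

variable {𝕜 : Type v} [RCLike 𝕜] {X : Type u} [NormedAddCommGroup X] [NormedSpace 𝕜 X]

/-- The support of `x = ∑ₙ xₙ eₙ`, where the basis is enumerated as `e₁, e₂, …`
(so `eₙ` is `b (n - 1)`). -/
def supp (b : SchauderBasis 𝕜 X) (x : X) : Set ℕ+ :=
  {n | b.coord n.natPred x ≠ 0}

/-- `x < y`, i.e. `max (supp x) < min (supp y)`. -/
def Precedes (b : SchauderBasis 𝕜 X) (x y : X) : Prop :=
  ∀ i ∈ supp b x, ∀ j ∈ supp b y, i < j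

variable (𝕜) in
/-- `(xᵢ)` is `K`-equivalent to the unit vector basis of `ℓ₁` of the same (finite) dimension. -/
def IsL1Equiv (K : ℝ) {ι : Type*} [Fintype ι] (x : ι → X) : Prop :=
  ∀ a : ι → 𝕜, ∑ i, ‖a i‖ ≤ K * ‖∑ i, a i • x i‖

/-- `T` is an `ℓ₁`-`K`-block tree on the space `X` with basis `b`. -/
def IsL1BlockTree (b : SchauderBasis 𝕜 X) (K : ℝ) (T : Set (List X)) : Prop :=
  IsTree T ∧ ∀ l ∈ T, (∀ x ∈ l, ‖x‖ = 1) ∧ l.Pairwise (Precedes b) ∧ IsL1Equiv 𝕜 K l.get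

/-- `I_b(X, K)`: the supremum of the orders of the well-founded `ℓ₁`-`K`-block trees on `X`. -/
def blockIndexAt (b : SchauderBasis 𝕜 X) (K : ℝ) : Ordinal.{u} :=
  sSup {o | ∃ T : Set (List X), IsL1BlockTree b K T ∧ IsWellFoundedTree T ∧ o = order T}

/-- The Bourgain `ℓ₁`-block index `I_b(X) = sup {I_b(X, K) : K ≥ 1}`. -/
def blockIndex (b : SchauderBasis 𝕜 X) : Ordinal.{u} :=
  sSup {o | ∃ K : ℝ, 1 ≤ K ∧ o = blockIndexAt b K}

/-- The suprema above are taken over sets that are bounded above. -/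
theorem bddAbove_blockIndexAt (b : SchauderBasis 𝕜 X) (K : ℝ) :
    BddAbove {o : Ordinal.{u} |
      ∃ T : Set (List X), IsL1BlockTree b K T ∧ IsWellFoundedTree T ∧ o = order T} :=
  (Ordinal.bddAbove_of_small (s := Set.range (fun T : Set (List X) => order T))).mono
    (by rintro _ ⟨T, _, _, rfl⟩; exact ⟨T, rfl⟩)

theorem bddAbove_blockIndex (b : SchauderBasis 𝕜 X) :
    BddAbove {o : Ordinal.{u} | ∃ K : ℝ, 1 ≤ K ∧ o = blockIndexAt b K} :=
  (Ordinal.bddAbove_of_small (s := Set.range (blockIndexAt b))).mono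
    (by rintro _ ⟨K, _, rfl⟩; exact ⟨K, rfl⟩)

/-- The normalized block sequence `(xᵢ)` generates an `ℓ₁^α`-spreading model with constant `C`. -/
def GeneratesL1SpreadingModel (b : SchauderBasis 𝕜 X) (c : Ordinal.{u} → ℕ+ → Ordinal.{u})
    (α : Ordinal.{u}) (C : ℝ) (x : ℕ+ → X) : Prop :=
  (∀ i, ‖x i‖ = 1) ∧ (∀ i j, i < j → Precedes b (x i) (x j)) ∧
    ∀ F ∈ schreier c α, IsL1Equiv 𝕜 C (fun i : F => x i)

/-- Some normalized block sequence generates an `ℓ₁^α`-spreading model with some constant. -/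
def AdmitsL1SpreadingModel (b : SchauderBasis 𝕜 X) (c : Ordinal.{u} → ℕ+ → Ordinal.{u})
    (α : Ordinal.{u}) : Prop :=
  ∃ C : ℝ, 1 ≤ C ∧ ∃ x : ℕ+ → X, GeneratesL1SpreadingModel b c α C x

/-- `X` is `ℓ₁^α`-asymptotic (with some constant `C`): every normalized finite sequence that is
`α`-admissible with respect to the basis is `C`-equivalent to the unit vector basis of `ℓ₁`. -/
def IsL1Asymptotic (b : SchauderBasis 𝕜 X) (c : Ordinal.{u} → ℕ+ → Ordinal.{u})
    (α : Ordinal.{u}) : Prop :=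
  ∃ C : ℝ, 1 ≤ C ∧ ∀ (k : ℕ) (x : Fin k → X), (∀ i, ‖x i‖ = 1) →
    IsAdmissible (schreier c α) (fun i => supp b (x i)) → IsL1Equiv 𝕜 C x

end Banach

end BlockIndex

end

noncomputable section

namespace BlockIndex

open Filter

/-! ### Ranks of families of finite sets -/

/-! Families of finite index sets are measured by a rank in which all large one-point extensions
must work, so finitely many conditions can be met at once. Composing families multiplies ranks
(`HasRank.comp`), and since the successor step composes with a family of rank `ω`, `𝓢_α` has rank at
least `ω ^ α` at `∅` (`hasRank_schreier`).

A rank at a singleton becomes a tree order. The tree of all sequences indexed by an `ℓ₁` family may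
have infinite branches, so each index gets an ordinal label and only label-decreasing sequences are
kept. This is well-founded, and since every label `≤ δ` occurs infinitely often, no rank is lost
(`exists_tree_lt_order`).

(1) Rank `ω ^ α` at `∅` gives singletons only smaller ranks. Adjoining `x 1` to all later sets, at
the cost of a larger constant, gives `{1}` rank `ω ^ α`, hence strict inequality.

(2) For the normalized basis, composing `𝓢_α` with an `ℓ₁` family of constant `K` stays inside the
one of constant `K * C`. Iteration yields rank `ω ^ (α * n)` for every `n`. -/

/-- `HasRank 𝓕 ξ F`: the finite set `F` belongs to `𝓕` and, for every `η < ξ`, all sufficiently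
large `x` can be added to `F` in such a way that the rank `η` is kept. -/
inductive HasRank (𝓕 : Set (Finset ℕ+)) : Ordinal.{u} → Finset ℕ+ → Prop
  | intro {ξ : Ordinal.{u}} {F : Finset ℕ+} (N : Ordinal.{u} → ℕ+) (mem : F ∈ 𝓕)
      (h : ∀ η < ξ, ∀ x, N η ≤ x → HasRank 𝓕 η (insert x F)) : HasRank 𝓕 ξ F

/-- This is the working form of the definition; `N` in the constructor merely chooses the
thresholds, keeping the recursive occurrence strictly positive. -/
theorem hasRank_iff {𝓕 : Set (Finset ℕ+)} {ξ : Ordinal.{u}} {F : Finset ℕ+} :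
    HasRank 𝓕 ξ F ↔ F ∈ 𝓕 ∧ ∀ η < ξ, ∀ᶠ x in atTop, HasRank 𝓕 η (insert x F) := by
  constructor
  · rintro ⟨N, mem, h⟩
    exact ⟨mem, fun η hη => eventually_atTop.2 ⟨N η, h η hη⟩⟩
  · rintro ⟨mem, h⟩
    have h' : ∀ η : Ordinal.{u}, ∃ N : ℕ+, η < ξ → ∀ x, N ≤ x → HasRank 𝓕 η (insert x F) := by
      intro η
      by_cases hη : η < ξ
      · obtain ⟨N, hN⟩ := eventually_atTop.1 (h η hη)
        exact ⟨N, fun _ => hN⟩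
      · exact ⟨1, fun h => absurd h hη⟩
    choose N hN using h'
    exact ⟨N, mem, hN⟩

theorem HasRank.mem {𝓕 : Set (Finset ℕ+)} {ξ : Ordinal.{u}} {F : Finset ℕ+}
    (h : HasRank 𝓕 ξ F) : F ∈ 𝓕 := (hasRank_iff.1 h).1

theorem HasRank.eventually {𝓕 : Set (Finset ℕ+)} {ξ η : Ordinal.{u}} {F : Finset ℕ+}
    (h : HasRank 𝓕 ξ F) (hη : η < ξ) : ∀ᶠ x in atTop, HasRank 𝓕 η (insert x F) :=
  (hasRank_iff.1 h).2 η hη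

theorem HasRank.of_le {𝓕 : Set (Finset ℕ+)} {ξ η : Ordinal.{u}} {F : Finset ℕ+}
    (h : HasRank 𝓕 ξ F) (hη : η ≤ ξ) : HasRank 𝓕 η F :=
  hasRank_iff.2 ⟨h.mem, fun _ hδ => h.eventually (hδ.trans_le hη)⟩

/-- If adding `E` to the sets of `𝓕` contained in `[n, ∞)` leads into `𝓖`, then ranks
are not decreased. -/
theorem HasRank.union_left {𝓕 𝓖 : Set (Finset ℕ+)} {n : ℕ+} {E : Finset ℕ+}
    (hE : ∀ F ∈ 𝓕, (∀ k ∈ F, n ≤ k) → E ∪ F ∈ 𝓖) {ξ : Ordinal.{u}} {F : Finset ℕ+}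
    (h : HasRank 𝓕 ξ F) (hn : ∀ k ∈ F, n ≤ k) : HasRank 𝓖 ξ (E ∪ F) := by
  induction ξ using WellFoundedLT.induction generalizing F with
  | ind ξ ih =>
    refine hasRank_iff.2 ⟨hE F h.mem hn, fun η hη => ?_⟩
    filter_upwards [h.eventually hη, eventually_ge_atTop n] with x hx hnx
    rw [← Finset.union_insert]
    exact ih η hη hx (by simpa using ⟨hnx, hn⟩)

theorem HasRank.mono {𝓕 𝓖 : Set (Finset ℕ+)} (hsub : 𝓕 ⊆ 𝓖) {ξ : Ordinal.{u}} {F : Finset ℕ+}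
    (h : HasRank 𝓕 ξ F) : HasRank 𝓖 ξ F := by
  simpa using h.union_left (𝓖 := 𝓖) (n := 1) (E := ∅) (fun F hF _ => by simpa using hsub hF)
    (fun k _ => one_le)

/-! ### Composition of families -/

/-- The sets `G i`, `i ∈ A`, are successive members of `𝓖` with `min (G i) = i`. -/
structure IsDecomposition (𝓖 : Set (Finset ℕ+)) (A : Finset ℕ+) (G : ℕ+ → Finset ℕ+) : Prop where
  mem : ∀ i ∈ A, G i ∈ 𝓖
  isLeast : ∀ i ∈ A, IsLeast (G i : Set ℕ+) i
  lt : ∀ i ∈ A, ∀ j ∈ A, i < j → ∀ a ∈ G i, ∀ b ∈ G j, a < b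

/-- The family of all unions `G₁ ∪ … ∪ Gₘ` of successive nonempty members of `𝓖` whose minima
form a set in `𝓐`. -/
def comp (𝓐 𝓖 : Set (Finset ℕ+)) : Set (Finset ℕ+) :=
  {H | ∃ A ∈ 𝓐, ∃ G, IsDecomposition 𝓖 A G ∧ A.biUnion G = H}

theorem eventually_forall_lt (H : Finset ℕ+) : ∀ᶠ x in atTop, ∀ a ∈ H, a < x :=
  (Finset.eventually_all H).2 fun a _ => eventually_gt_atTop a

theorem IsDecomposition.lt_of_biUnion {𝓖 : Set (Finset ℕ+)} {A : Finset ℕ+} {G : ℕ+ → Finset ℕ+}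
    (h : IsDecomposition 𝓖 A G) {x : ℕ+} (hx : ∀ a ∈ A.biUnion G, a < x) {i : ℕ+} (hi : i ∈ A) :
    i < x :=
  hx i (Finset.mem_biUnion.2 ⟨i, hi, (h.isLeast i hi).1⟩)

theorem IsDecomposition.insert_singleton {𝓖 : Set (Finset ℕ+)} {A : Finset ℕ+}
    {G : ℕ+ → Finset ℕ+} (h : IsDecomposition 𝓖 A G) {x : ℕ+}
    (hx : ∀ a ∈ A.biUnion G, a < x) (hxG : {x} ∈ 𝓖) :
    IsDecomposition 𝓖 (insert x A) (Function.update G x {x}) ∧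
      (insert x A).biUnion (Function.update G x {x}) = insert x (A.biUnion G) := by
  have hA : ∀ i ∈ A, i < x := fun i hi => h.lt_of_biUnion hx hi
  have hup : ∀ i ∈ A, Function.update G x {x} i = G i := fun i hi =>
    Function.update_of_ne (hA i hi).ne _ _
  refine ⟨⟨?_, ?_, ?_⟩, ?_⟩
  · intro i hi
    rcases Finset.mem_insert.1 hi with rfl | hi
    · simpa using hxG
    · rw [hup i hi]; exact h.mem i hi
  · intro i hi
    rcases Finset.mem_insert.1 hi with rfl | hi
    · simp
    · rw [hup i hi]; exact h.isLeast i hi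
  · intro i hi j hj hij a ha d hd
    rcases Finset.mem_insert.1 hi with rfl | hi
    · rcases Finset.mem_insert.1 hj with rfl | hj
      · exact absurd hij (lt_irrefl _)
      · exact absurd (hA j hj) hij.asymm
    · rw [hup i hi] at ha
      rcases Finset.mem_insert.1 hj with rfl | hj
      · rw [Function.update_self, Finset.mem_singleton] at hd
        exact hd ▸ hx a (Finset.mem_biUnion.2 ⟨i, ‹i ∈ A›, ha⟩)
      · rw [hup j hj] at hd
        exact h.lt i hi j hj hij a ha d hd
  · rw [Finset.biUnion_insert, Function.update_self, Finset.biUnion_congr rfl hup]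
    rfl

theorem IsDecomposition.insert_last {𝓖 : Set (Finset ℕ+)} {A : Finset ℕ+}
    {G : ℕ+ → Finset ℕ+} (h : IsDecomposition 𝓖 A G) {x i : ℕ+} (hi : IsGreatest (A : Set ℕ+) i)
    (hx : ∀ a ∈ A.biUnion G, a < x) (hxG : insert x (G i) ∈ 𝓖) :
    IsDecomposition 𝓖 A (Function.update G i (insert x (G i))) ∧
      A.biUnion (Function.update G i (insert x (G i))) = insert x (A.biUnion G) := by
  have hiA : i ∈ A := hi.1
  have hsub : ∀ j a, a ∈ Function.update G i (insert x (G i)) j ↔ a ∈ G j ∨ (j = i ∧ a = x) := by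
    intro j a
    by_cases hj : j = i
    · subst hj; simp [or_comm]
    · simp [hj]
  refine ⟨⟨?_, ?_, ?_⟩, ?_⟩
  · intro j hj
    by_cases hji : j = i
    · subst hji; simpa using hxG
    · rw [Function.update_of_ne hji]; exact h.mem j hj
  · intro j hj
    refine ⟨(hsub j j).2 (Or.inl (h.isLeast j hj).1), fun a ha => ?_⟩
    rcases (hsub j a).1 ha with ha | ⟨rfl, rfl⟩
    · exact (h.isLeast j hj).2 ha
    · exact (h.lt_of_biUnion hx hj).le
  · intro j hj k hk hjk a ha d hd
    rcases (hsub j a).1 ha with ha | ⟨rfl, rfl⟩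
    · rcases (hsub k d).1 hd with hd | ⟨rfl, rfl⟩
      · exact h.lt j hj k hk hjk a ha d hd
      · exact hx a (Finset.mem_biUnion.2 ⟨j, hj, ‹a ∈ G j›⟩)
    · exact absurd (hi.2 hk) hjk.not_ge
  · ext a
    simp only [Finset.mem_biUnion, Finset.mem_insert, hsub]
    constructor
    · rintro ⟨j, hj, ha | ⟨rfl, rfl⟩⟩
      · exact Or.inr ⟨j, hj, ha⟩
      · exact Or.inl rfl
    · rintro (rfl | ⟨j, hj, ha⟩)
      · exact ⟨i, hiA, Or.inr ⟨rfl, rfl⟩⟩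
      · exact ⟨j, hj, Or.inl ha⟩

/-- `η` measures how many blocks can still be opened, `ζ` how far the last block can still grow. An
ordinal below `β * η + ζ` is either `β * q + r` with `q < η` and `r < β`, reached by opening the
block `{x}`, or `β * η + r` with `r < ζ`, reached by adding `x` to the last block. -/
theorem HasRank.comp_of_decomposition {𝓐 𝓖 : Set (Finset ℕ+)} {β : Ordinal.{u}}
    (hβ : HasRank 𝓖 β ∅) {δ η ζ : Ordinal.{u}} {A : Finset ℕ+} {G : ℕ+ → Finset ℕ+} {i : ℕ+}
    (hG : IsDecomposition 𝓖 A G) (hi : IsGreatest (A : Set ℕ+) i) (hA : HasRank 𝓐 η A)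
    (hGi : HasRank 𝓖 ζ (G i)) (hδ : δ = β * η + ζ) :
    HasRank (comp 𝓐 𝓖) δ (A.biUnion G) := by
  induction δ using WellFoundedLT.induction generalizing η ζ A G i with
  | ind δ ih =>
    subst hδ
    refine hasRank_iff.2 ⟨⟨A, hA.mem, G, hG, rfl⟩, fun δ hδ => ?_⟩
    rcases lt_or_ge δ (β * η) with hlt | hge
    · obtain ⟨q, hq, r, hr, rfl⟩ := Ordinal.lt_mul_iff.1 hlt
      filter_upwards [hA.eventually hq, hβ.eventually hr, eventually_forall_lt (A.biUnion G)]
        with x h1 h2 h3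
      obtain ⟨h4, h5⟩ := hG.insert_singleton h3 h2.mem
      rw [← h5]
      refine ih _ hδ h4 (i := x) ⟨by simp, ?_⟩ h1 (by simpa using h2) rfl
      intro j hj
      rcases Finset.mem_insert.1 (Finset.mem_coe.1 hj) with rfl | hj
      · exact le_rfl
      · exact (hG.lt_of_biUnion h3 hj).le
    · obtain ⟨r, rfl⟩ := exists_add_of_le hge
      filter_upwards [hGi.eventually ((add_lt_add_iff_left _).1 hδ),
        eventually_forall_lt (A.biUnion G)] with x h1 h2
      obtain ⟨h4, h5⟩ := hG.insert_last hi h2 h1.mem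
      rw [← h5]
      exact ih _ hδ h4 hi hA (by simpa using h1) rfl

theorem HasRank.comp {𝓐 𝓖 : Set (Finset ℕ+)} {γ β : Ordinal.{u}}
    (hγ : HasRank 𝓐 γ ∅) (hβ : HasRank 𝓖 β ∅) : HasRank (comp 𝓐 𝓖) (β * γ) ∅ := by
  have h0 : IsDecomposition 𝓖 ∅ (fun _ => ∅) := ⟨by simp, by simp, by simp⟩
  refine hasRank_iff.2 ⟨⟨∅, hγ.mem, _, h0, rfl⟩, fun δ hδ => ?_⟩
  -- The empty decomposition has no last block, so the first point can only open one.
  obtain ⟨q, hq, r, hr, rfl⟩ := Ordinal.lt_mul_iff.1 hδ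
  filter_upwards [hγ.eventually hq, hβ.eventually hr] with x h1 h2
  obtain ⟨h4, h5⟩ := h0.insert_singleton (x := x) (by simp) h2.mem
  rw [Finset.biUnion_empty] at h5
  rw [← h5]
  exact HasRank.comp_of_decomposition hβ (i := x) h4 (by simp) h1 (by simpa using h2) rfl

/-! ### The rank of the Schreier families -/

/-- The hypothesis leaves room for `n` further points before the cardinality exceeds the minimum. -/
theorem hasRank_card_le_natCast (n : ℕ) (F : Finset ℕ+) (h : ∀ x ∈ F, F.card + n ≤ x) :
    HasRank.{u} {F : Finset ℕ+ | ∀ x ∈ F, F.card ≤ x} n F := by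
  induction n using Nat.strong_induction_on generalizing F with
  | _ n ih =>
    refine hasRank_iff.2 ⟨fun x hx => by have := h x hx; omega, fun η hη => ?_⟩
    obtain ⟨k, rfl⟩ := Ordinal.lt_omega0.1 (hη.trans (Ordinal.natCast_lt_omega0 n))
    have hk : k < n := by exact_mod_cast hη
    filter_upwards [eventually_ge_atTop (⟨F.card + n + 1, by omega⟩ : ℕ+)] with x hx
    have hx' : F.card + n + 1 ≤ x := hx
    refine ih k hk _ fun y hy => ?_
    have hcard := Finset.card_insert_le x F
    rcases Finset.mem_insert.1 hy with rfl | hy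
    · omega
    · have := h y hy
      omega

theorem hasRank_card_le : HasRank.{u} {F : Finset ℕ+ | ∀ x ∈ F, F.card ≤ x} ω ∅ := by
  refine hasRank_iff.2 ⟨by simp, fun η hη => ?_⟩
  obtain ⟨k, rfl⟩ := Ordinal.lt_omega0.1 hη
  filter_upwards [eventually_ge_atTop (⟨k + 1, by omega⟩ : ℕ+)] with x hx
  have hx' : k + 1 ≤ x := hx
  refine hasRank_card_le_natCast k _ fun y hy => ?_
  rw [insert_empty_eq, Finset.mem_singleton] at hy
  subst hy
  simp
  omega

theorem comp_card_le_subset_schreierStep {𝓖 : Set (Finset ℕ+)} (h : ∅ ∈ 𝓖) :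
    comp {F : Finset ℕ+ | ∀ x ∈ F, F.card ≤ x} 𝓖 ⊆ schreierStep 𝓖 := by
  rintro _ ⟨A, hA, G, hG, rfl⟩
  rcases A.eq_empty_or_nonempty with rfl | hne
  -- The number of pieces must be positive, so the empty union is written with one empty piece.
  · exact ⟨1, fun _ => ∅, fun _ => h, by simp, by simp, by ext; simp⟩
  · have hmem : ∀ t, A.orderEmbOfFin rfl t ∈ A := fun t => Finset.orderEmbOfFin_mem A rfl t
    refine ⟨⟨A.card, hne.card_pos⟩, fun t => G (A.orderEmbOfFin rfl t),
      fun t => hG.mem _ (hmem t), fun t k hk => ?_, fun s t hst => ?_, ?_⟩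
    · exact (show _ ≤ A.orderEmbOfFin rfl t from hA _ (hmem t)).trans
        ((hG.isLeast _ (hmem t)).2 hk)
    · exact hG.lt _ (hmem s) _ (hmem t) ((A.orderEmbOfFin rfl).strictMono hst)
    · refine Finset.ext fun a => ⟨fun ha => Finset.mem_biUnion.2 ?_, fun ha => ?_⟩
      · obtain ⟨i, hi, ha⟩ := Finset.mem_biUnion.1 ha
        rw [← Finset.mem_coe, ← Finset.range_orderEmbOfFin A rfl] at hi
        obtain ⟨t, rfl⟩ := hi
        exact ⟨t, Finset.mem_univ _, ha⟩
      · obtain ⟨t, -, ha⟩ := Finset.mem_biUnion.1 ha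
        exact Finset.mem_biUnion.2 ⟨_, hmem t, ha⟩

theorem hasRank_schreier {c : Ordinal.{u} → ℕ+ → Ordinal.{u}} (hc : IsLadder c)
    (α : Ordinal.{u}) (hα : α < ω₁) : HasRank (schreier c α) (ω ^ α) ∅ := by
  induction α using Ordinal.limitRecOn with
  | zero =>
    rw [schreier_zero, Ordinal.opow_zero]
    refine hasRank_iff.2 ⟨by simp, fun η hη => Eventually.of_forall fun x => ?_⟩
    rw [Order.lt_one_iff] at hη
    subst hη
    exact hasRank_iff.2 ⟨by simp, fun η hη => absurd hη not_lt_zero⟩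
  | add_one α ih =>
    have h := ih ((lt_add_one α).trans hα)
    rw [schreier_succ, Ordinal.opow_add, Ordinal.opow_one]
    exact (hasRank_card_le.comp h).mono (comp_card_le_subset_schreierStep h.mem)
  | limit α hlim ih =>
    have hmem : ∀ n, ∀ F ∈ schreier c (c α n), (∀ k ∈ F, n ≤ k) → ∅ ∪ F ∈ schreier c α := by
      intro n F hF hn
      rw [schreier_limit hc hlim hα, Finset.empty_union]
      exact ⟨n, hF, hn⟩
    have hlt := hc.lt hlim hα
    refine hasRank_iff.2 ⟨?_, fun δ hδ => ?_⟩
    · exact hmem 1 ∅ (ih _ (hlt 1) ((hlt 1).trans hα)).mem (by simp)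
    -- `δ` already lies below `ω ^ c α n` for some `n`, and points `≥ n` may be taken from that
    -- family.
    · obtain ⟨α', hα', hδ'⟩ := (Ordinal.lt_opow_of_isSuccLimit Ordinal.omega0_ne_zero hlim).1 hδ
      obtain ⟨_, ⟨n, rfl⟩, hn⟩ := (lt_isLUB_iff (hc α hlim hα).2).1 hα'
      have hδn : δ < ω ^ c α n :=
        hδ'.trans_le (Ordinal.opow_le_opow_right Ordinal.omega0_pos hn.le)
      filter_upwards [(ih _ (hlt n) ((hlt n).trans hα)).eventually hδn, eventually_ge_atTop n]
        with x hx hnx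
      simpa using hx.union_left (hmem n) (by simpa using hnx)

/-! ### Trees with strictly decreasing ordinal labels -/

section Labels

variable {S : Type u}

theorem mem_and_le_label_of_mem_iterDerive {T : Set (List S)} (hT : IsTree T)
    {lab : S → Ordinal.{u}} (hlab : ∀ l ∈ T, l.Pairwise fun y z => lab z < lab y)
    (ξ : Ordinal.{u}) {l : List S} (hl : l ∈ iterDerive T ξ) : l ∈ T ∧ ∀ y ∈ l, ξ ≤ lab y := by
  induction ξ using Ordinal.limitRecOn generalizing l with
  | zero => exact ⟨by rwa [iterDerive_zero] at hl, fun _ _ => zero_le⟩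
  | add_one ξ ih =>
    rw [iterDerive_succ] at hl
    obtain ⟨hne, x, hx⟩ := hl
    obtain ⟨h1, h2⟩ := ih hx
    refine ⟨hT.2 l hne x h1, fun y hy => Order.add_one_le_of_lt ?_⟩
    exact (h2 x (by simp)).trans_lt ((List.pairwise_append.1 (hlab _ h1)).2.2 y hy x (by simp))
  | limit ξ hξ ih =>
    rw [iterDerive_limit T hξ, Set.mem_iInter₂] at hl
    refine ⟨(ih 0 hξ.bot_lt (hl 0 hξ.bot_lt)).1, fun y hy => ?_⟩
    exact (Order.IsSuccLimit.le_iff_forall_le hξ).2 fun η hη => (ih η hη (hl η hη)).2 y hy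

/-- The labels are bounded, so some derivative is empty; without this the infimum defining `order`
could be the default value `0`. -/
theorem lt_order_of_label {T : Set (List S)} (hT : IsTree T)
    {lab : S → Ordinal.{u}} (hlab : ∀ l ∈ T, l.Pairwise fun y z => lab z < lab y)
    {δ : Ordinal.{u}} (hδ : ∀ ξ ≤ δ, (iterDerive T ξ).Nonempty) : δ < order T := by
  have hne : {ξ : Ordinal.{u} | iterDerive T ξ = ∅}.Nonempty := by
    obtain ⟨B, hB⟩ := Ordinal.bddAbove_of_small (s := Set.range lab)
    refine ⟨B + 1, Set.eq_empty_of_forall_notMem fun l hl => ?_⟩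
    obtain ⟨hlT, h⟩ := mem_and_le_label_of_mem_iterDerive hT hlab _ hl
    obtain ⟨y, hy⟩ := List.exists_mem_of_ne_nil l (fun h => hT.1 (h ▸ hlT))
    exact ((lt_add_one B).trans_le (h y hy)).not_ge (hB ⟨y, rfl⟩)
  by_contra hle
  exact (hδ _ (not_lt.1 hle)).ne_empty (csInf_mem hne)

theorem isWellFoundedTree_of_label {T : Set (List S)}
    {lab : S → Ordinal.{u}} (hlab : ∀ l ∈ T, l.Pairwise fun y z => lab z < lab y) :
    IsWellFoundedTree T := by
  rintro ⟨f, hf⟩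
  have hdec : ∀ k, lab (f (k + 1)) < lab (f k) := fun k => by
    have := List.pairwise_ofFn.1 (hlab _ (hf (k + 1)))
      (i := ⟨k, by omega⟩) (j := ⟨k + 1, by omega⟩) (by simp)
    simpa using this
  exact (RelEmbedding.natGT (fun k => lab (f k)) hdec).not_wellFounded
    (wellFounded_lt (α := Ordinal.{u}))

theorem exists_label {δ : Ordinal.{u}} (hδ : δ < ω₁) (n : ℕ+) :
    ∃ e : ℕ+ → Ordinal.{u}, e n = δ ∧ ∀ η ≤ δ, ∃ᶠ m in atTop, e m = η := by
  have hcount : (Set.Iic δ).Countable := by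
    rw [← Set.Iio_insert]
    refine Set.Countable.insert _ ?_
    rw [← Cardinal.le_aleph0_iff_set_countable, Cardinal.mk_Iio_ordinal, Cardinal.lift_le_aleph0,
      ← Order.lt_succ_iff, Cardinal.succ_aleph0]
    exact Cardinal.lt_omega_iff_card_lt.1 hδ
  obtain ⟨f, hf⟩ := hcount.exists_eq_range ⟨δ, Set.mem_Iic.2 le_rfl⟩
  refine ⟨Function.update (fun m => f m.natPred.unpair.1) n δ, by simp, fun η hη => ?_⟩
  obtain ⟨k, rfl⟩ : η ∈ Set.range f := hf ▸ hη
  -- The first component of the pair encodes the label; the second pushes the index beyond both `N`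
  -- and the exceptional index `n`.
  refine frequently_atTop.2 fun N => ⟨(Nat.pair k (max N n)).succPNat, ?_, ?_⟩
  · have := Nat.right_le_pair k (max N n)
    rw [← PNat.coe_le_coe, Nat.succPNat_coe]
    omega
  · rw [Function.update_of_ne]
    · simp
    · intro h
      have h1 := Nat.right_le_pair k (max N n)
      have h2 := congrArg PNat.val h
      rw [Nat.succPNat_coe] at h2
      change _ = (n : ℕ) at h2
      omega

/-- The tree of all sequences `(x i)`, where `i` runs through a nonempty member of `𝓕` along
which the labels `e i` decrease strictly. -/
def labelTree (x : ℕ+ → S) (𝓕 : Set (Finset ℕ+)) (e : ℕ+ → Ordinal.{u}) : Set (List S) :=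
  {l | l ≠ [] ∧ ∃ s : List ℕ+, s.Pairwise (· < ·) ∧ s.Pairwise (fun i j => e j < e i) ∧
    s.toFinset ∈ 𝓕 ∧ s.map x = l}

theorem isTree_labelTree (x : ℕ+ → S) {𝓕 : Set (Finset ℕ+)}
    (h𝓕 : ∀ F ∈ 𝓕, ∀ G ⊆ F, G ∈ 𝓕) (e : ℕ+ → Ordinal.{u}) : IsTree (labelTree x 𝓕 e) := by
  refine ⟨fun h => h.1 rfl, ?_⟩
  rintro l hl y ⟨-, s, h1, h2, h3, h4⟩
  obtain ⟨s₁, s₂, rfl, rfl, -⟩ := List.map_eq_append_iff.1 h4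
  refine ⟨hl, s₁, (List.pairwise_append.1 h1).1, (List.pairwise_append.1 h2).1, ?_, rfl⟩
  exact h𝓕 _ h3 _ (by rw [List.toFinset_append]; exact Finset.subset_union_left)

/-- At a successor `ξ + 1`, all large `m` keep rank `ξ` and infinitely many `m` carry the label `ξ`,
which lies below all labels used so far; so some `m` does both. -/
theorem map_mem_iterDerive_labelTree (x : ℕ+ → S) {𝓕 : Set (Finset ℕ+)}
    {e : ℕ+ → Ordinal.{u}} {δ : Ordinal.{u}} (he : ∀ η ≤ δ, ∃ᶠ m in atTop, e m = η)
    {ξ : Ordinal.{u}} (hξ : ξ ≤ δ) {s : List ℕ+} (hne : s ≠ []) (h1 : s.Pairwise (· < ·))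
    (h2 : s.Pairwise (fun i j => e j < e i)) (h3 : HasRank 𝓕 ξ s.toFinset)
    (h4 : ∀ i ∈ s, ξ ≤ e i) : s.map x ∈ iterDerive (labelTree x 𝓕 e) ξ := by
  induction ξ using Ordinal.limitRecOn generalizing s with
  | zero =>
    rw [iterDerive_zero]
    exact ⟨by simpa using hne, s, h1, h2, h3.mem, rfl⟩
  | add_one ξ ih =>
    have hlt := lt_add_one ξ
    obtain ⟨m, h5, h6, h7⟩ := ((he ξ (hlt.le.trans hξ)).and_eventually
      ((h3.eventually hlt).and (eventually_forall_lt s.toFinset))).exists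
    rw [iterDerive_succ]
    refine ⟨by simpa using hne, x m, ?_⟩
    have h8 := ih (hlt.le.trans hξ) (s := s ++ [m]) (by simp) ?_ ?_ ?_ ?_
    · simpa using h8
    · refine List.pairwise_append.2 ⟨h1, by simp, fun a ha c hc => ?_⟩
      rw [List.mem_singleton.1 hc]
      exact h7 a (by simpa using ha)
    · refine List.pairwise_append.2 ⟨h2, by simp, fun a ha c hc => ?_⟩
      rw [List.mem_singleton.1 hc, h5]
      exact hlt.trans_le (h4 a ha)
    · have : (s ++ [m]).toFinset = insert m s.toFinset := by ext; simp
      rwa [this]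
    · intro i hi
      rcases List.mem_append.1 hi with hi | hi
      · exact hlt.le.trans (h4 i hi)
      · rw [List.mem_singleton.1 hi, h5]
  | limit ξ hlim ih =>
    rw [iterDerive_limit _ hlim, Set.mem_iInter₂]
    exact fun η hη => ih η hη (hη.le.trans hξ) hne h1 h2 (h3.of_le hη.le)
      fun i hi => hη.le.trans (h4 i hi)

theorem exists_tree_lt_order {x : ℕ+ → S} (hx : Function.Injective x) {𝓕 : Set (Finset ℕ+)}
    (h𝓕 : ∀ F ∈ 𝓕, ∀ G ⊆ F, G ∈ 𝓕) {δ : Ordinal.{u}} (hδ : δ < ω₁) {n : ℕ+}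
    (h : HasRank 𝓕 δ {n}) :
    ∃ T : Set (List S), IsTree T ∧ IsWellFoundedTree T ∧ δ < order T ∧
      ∀ l ∈ T, ∃ s : List ℕ+, s.Pairwise (· < ·) ∧ s.toFinset ∈ 𝓕 ∧ s.map x = l := by
  obtain ⟨e, hen, he⟩ := exists_label hδ n
  have hT := isTree_labelTree x h𝓕 e
  have hlab : ∀ l ∈ labelTree x 𝓕 e,
      -- Injectivity of `x` lets the labels be read off from the vectors.
      l.Pairwise fun y z => e (Function.invFun x z) < e (Function.invFun x y) := by
    rintro _ ⟨-, s, -, h2, -, rfl⟩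
    rw [List.pairwise_map]
    simpa only [Function.leftInverse_invFun hx _] using h2
  refine ⟨labelTree x 𝓕 e, hT, isWellFoundedTree_of_label hlab,
    lt_order_of_label hT hlab fun ξ hξ => ⟨[n].map x, ?_⟩, ?_⟩
  · exact map_mem_iterDerive_labelTree x he hξ (by simp) (by simp) (by simp)
      (by simpa using h.of_le hξ) (by simpa [hen] using hξ)
  · rintro l ⟨-, s, h1, -, h3, h4⟩
    exact ⟨s, h1, h3, h4⟩

end Labels

/-! ### Block sequences -/

section Banach

variable {𝕜 : Type v} [RCLike 𝕜] {X : Type u} [NormedAddCommGroup X] [NormedSpace 𝕜 X]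

variable (𝕜) in
/-- The sets `F` such that `(xᵢ)_{i ∈ F}` is `K`-equivalent to the unit vector basis of `ℓ₁`. -/
def l1Family (x : ℕ+ → X) (K : ℝ) : Set (Finset ℕ+) :=
  {F | ∀ a : ℕ+ → 𝕜, ∑ i ∈ F, ‖a i‖ ≤ K * ‖∑ i ∈ F, a i • x i‖}

theorem mem_l1Family_of_subset {x : ℕ+ → X} {K : ℝ} {F G : Finset ℕ+} (hF : F ∈ l1Family 𝕜 x K)
    (hGF : G ⊆ F) : G ∈ l1Family 𝕜 x K := by
  intro a
  have h := hF (fun i => if i ∈ G then a i else 0)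
  simpa [ite_smul, apply_ite, Finset.sum_ite_mem, Finset.inter_eq_right.2 hGF] using h

theorem isL1Equiv_of_mem_l1Family {x : ℕ+ → X} {K : ℝ} {ι : Type*} [Fintype ι] {t : ι → ℕ+}
    (ht : Function.Injective t) (h : Finset.univ.image t ∈ l1Family 𝕜 x K) :
    IsL1Equiv 𝕜 K (fun i => x (t i)) := by
  intro a
  have := h (Function.extend t a 0)
  rw [Finset.sum_image ht.injOn, Finset.sum_image ht.injOn] at this
  simpa only [ht.extend_apply] using this

theorem mem_l1Family_of_isL1Equiv {x : ℕ+ → X} {K : ℝ} {F : Finset ℕ+}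
    (h : IsL1Equiv 𝕜 K (fun i : F => x i)) : F ∈ l1Family 𝕜 x K := by
  intro a
  have := h (fun i => a i)
  rwa [Finset.sum_coe_sort F (fun i => ‖a i‖), Finset.sum_coe_sort F (fun i => a i • x i)] at this

theorem supp_nonempty (b : SchauderBasis 𝕜 X) {x : X} (hx : x ≠ 0) : (supp b x).Nonempty := by
  by_contra h
  refine hx (tendsto_nhds_unique (b.tendsto_proj x) ?_)
  have h0 : ∀ n, b.coord n x = 0 := fun n => by
    by_contra hn
    exact h ⟨n.succPNat, by simpa [supp] using hn⟩
  simp [SchauderBasis.proj_apply, h0]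

theorem injective_of_precedes {b : SchauderBasis 𝕜 X} {x : ℕ+ → X} (hx : ∀ i, ‖x i‖ = 1)
    (hprec : ∀ i j, i < j → Precedes b (x i) (x j)) : Function.Injective x := by
  have hne : ∀ i j, i < j → x i ≠ x j := by
    intro i j hij h
    obtain ⟨k, hk⟩ := supp_nonempty b (x := x i) (by rw [← norm_ne_zero_iff, hx]; exact one_ne_zero)
    exact lt_irrefl k (hprec i j hij k hk k (h ▸ hk))
  intro i j h
  rcases lt_trichotomy i j with hij | hij | hij
  · exact absurd h (hne i j hij)
  · exact hij
  · exact absurd h.symm (hne j i hij)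

theorem lt_blockIndex {b : SchauderBasis 𝕜 X} {x : ℕ+ → X} (hx : ∀ i, ‖x i‖ = 1)
    (hprec : ∀ i j, i < j → Precedes b (x i) (x j)) {K : ℝ} (hK : 1 ≤ K) {δ : Ordinal.{u}}
    (hδ : δ < ω₁) {n : ℕ+} (h : HasRank (l1Family 𝕜 x K) δ {n}) : δ < blockIndex b := by
  obtain ⟨T, hT, hwf, hord, hmem⟩ := exists_tree_lt_order (injective_of_precedes hx hprec)
    (fun F hF G hG => mem_l1Family_of_subset hF hG) hδ h
  refine hord.trans_le (le_trans ?_ (le_csSup (bddAbove_blockIndex b) ⟨K, hK, rfl⟩))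
  refine le_csSup (bddAbove_blockIndexAt b K) ⟨T, ⟨hT, fun l hl => ?_⟩, hwf, rfl⟩
  obtain ⟨s, h1, h2, rfl⟩ := hmem l hl
  refine ⟨by simp [hx], List.pairwise_map.2 (h1.imp fun hij => hprec _ _ hij), ?_⟩
  have hget : (s.map x).get = fun i => x (s.get (i.cast (List.length_map x))) := by
    ext i; simp
  rw [hget]
  refine isL1Equiv_of_mem_l1Family ?_ ?_
  · exact (List.nodup_iff_injective_get.1 (h1.imp fun h => h.ne)).comp (Fin.cast_injective _)
  · convert h2
    ext a
    simp only [Finset.mem_image, Finset.mem_univ, true_and, List.mem_toFinset, List.mem_iff_get]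
    exact ⟨fun ⟨i, hi⟩ => ⟨_, hi⟩, fun ⟨i, hi⟩ => ⟨i.cast (List.length_map x).symm, hi⟩⟩

/-! ### Spreading models -/

/-- A coordinate functional `f` with `f (x 1) ≠ 0` vanishes on all later `x i`. Hence it bounds `‖a
1‖` by `D` times the norm of the whole sum, and the triangle inequality then controls the remaining
part. -/
theorem exists_insert_mem_l1Family {b : SchauderBasis 𝕜 X} {x : ℕ+ → X} (hx : ∀ i, ‖x i‖ = 1)
    (hprec : ∀ i j, i < j → Precedes b (x i) (x j)) {C : ℝ} (hC : 1 ≤ C) :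
    ∃ K : ℝ, 1 ≤ K ∧ ∀ F ∈ l1Family 𝕜 x C, (∀ k ∈ F, 2 ≤ k) → {1} ∪ F ∈ l1Family 𝕜 x K := by
  obtain ⟨k, hk⟩ := supp_nonempty b (x := x 1) (by rw [← norm_ne_zero_iff, hx]; exact one_ne_zero)
  set f := b.coord k.natPred with hf
  have hf1 : 0 < ‖f (x 1)‖ := norm_pos_iff.2 hk
  have hf0 : ∀ i, 1 < i → f (x i) = 0 := fun i hi => by
    by_contra h
    exact lt_irrefl k (hprec 1 i hi k hk k h)
  set D := ‖f‖ / ‖f (x 1)‖ with hD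
  have hD0 : 0 ≤ D := by positivity
  refine ⟨D + C * (1 + D), by nlinarith, fun F hF h2 a => ?_⟩
  have h2' : ∀ i ∈ F, 1 < i := fun i hi => lt_of_lt_of_le (by decide) (h2 i hi)
  have h1F : 1 ∉ F := fun h => lt_irrefl _ (h2' 1 h)
  rw [← Finset.insert_eq, Finset.sum_insert h1F, Finset.sum_insert h1F]
  set z := ∑ i ∈ F, a i • x i with hz
  have hfz : f z = 0 := by
    rw [hz, map_sum]
    exact Finset.sum_eq_zero fun i hi => by rw [map_smul, hf0 i (h2' i hi), smul_zero]
  have ha : ‖a 1‖ ≤ D * ‖a 1 • x 1 + z‖ := by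
    have h := f.le_opNorm (a 1 • x 1 + z)
    rw [map_add, map_smul, hfz, add_zero, norm_smul] at h
    rwa [hD, div_mul_eq_mul_div, le_div_iff₀ hf1]
  have hz1 : ‖z‖ ≤ ‖a 1 • x 1 + z‖ + ‖a 1‖ := by
    have h := norm_sub_le (a 1 • x 1 + z) (a 1 • x 1)
    rwa [add_sub_cancel_left, norm_smul, hx, mul_one] at h
  calc ‖a 1‖ + ∑ i ∈ F, ‖a i‖ ≤ D * ‖a 1 • x 1 + z‖ + C * ‖z‖ := add_le_add ha (hF a)
    _ ≤ D * ‖a 1 • x 1 + z‖ + C * (‖a 1 • x 1 + z‖ + D * ‖a 1 • x 1 + z‖) := by gcongr; linarith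
    _ = _ := by ring

theorem opow_lt_omega_one {α : Ordinal.{u}} (hα : α < ω₁) : ω ^ α < ω₁ :=
  Ordinal.isPrincipal_opow_omega 1 Ordinal.omega0_lt_omega_one hα

theorem AdmitsL1SpreadingModel.lt_blockIndex {b : SchauderBasis 𝕜 X}
    {c : Ordinal.{u} → ℕ+ → Ordinal.{u}} (hc : IsLadder c) {α : Ordinal.{u}} (hα : α < ω₁)
    (h : AdmitsL1SpreadingModel b c α) : ω ^ α < blockIndex b := by
  obtain ⟨C, hC, x, hx, hprec, hS⟩ := h
  obtain ⟨K, hK, hins⟩ := exists_insert_mem_l1Family hx hprec hC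
  have hrank : HasRank (l1Family 𝕜 x C) (ω ^ α) ∅ :=
    (hasRank_schreier hc α hα).mono fun F hF => mem_l1Family_of_isL1Equiv (hS F hF)
  exact BlockIndex.lt_blockIndex hx hprec hK (opow_lt_omega_one hα) (n := 1)
    (by simpa using hrank.union_left hins (by simp))

/-! ### Asymptotic spaces -/

/-- The inequality is closed in `a`, and nowhere-zero coefficients are dense. With such coefficients
a combination of basis vectors has full support, so minima of supports are known exactly. -/
theorem mem_l1Family_of_forall_ne_zero {x : ℕ+ → X} {K : ℝ} {F : Finset ℕ+}
    (h : ∀ a : ℕ+ → 𝕜, (∀ i, a i ≠ 0) → ∑ i ∈ F, ‖a i‖ ≤ K * ‖∑ i ∈ F, a i • x i‖) :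
    F ∈ l1Family 𝕜 x K := by
  have hclosed : IsClosed {a : ℕ+ → 𝕜 | ∑ i ∈ F, ‖a i‖ ≤ K * ‖∑ i ∈ F, a i • x i‖} :=
    isClosed_le (by fun_prop) (by fun_prop)
  have hdense : Dense (Set.univ.pi fun _ : ℕ+ => ({0}ᶜ : Set 𝕜)) :=
    dense_pi _ fun _ _ => dense_compl_singleton 0
  intro a
  refine hclosed.closure_subset_iff.2 (fun d hd => ?_) (hdense a)
  exact h d fun i => hd i (Set.mem_univ i)

/-- The normalized basis `eₙ / ‖eₙ‖`. -/
def normalizedBasis (b : SchauderBasis 𝕜 X) (n : ℕ+) : X :=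
  ((‖b n.natPred‖⁻¹ : ℝ) : 𝕜) • b n.natPred

theorem norm_normalizedBasis (b : SchauderBasis 𝕜 X) (n : ℕ+) : ‖normalizedBasis b n‖ = 1 := by
  have h : ‖b n.natPred‖ ≠ 0 := norm_ne_zero_iff.2 (b.linearIndependent.ne_zero _)
  rw [normalizedBasis, norm_smul, RCLike.norm_ofReal, abs_of_nonneg (by positivity),
    inv_mul_cancel₀ h]

theorem coord_normalizedBasis (b : SchauderBasis 𝕜 X) (m n : ℕ+) :
    b.coord m.natPred (normalizedBasis b n) =
      if m = n then ((‖b n.natPred‖⁻¹ : ℝ) : 𝕜) else 0 := by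
  classical
  rw [normalizedBasis, map_smul, b.ortho]
  by_cases h : m = n
  · subst h; simp
  · simp [h]

theorem supp_sum_normalizedBasis (b : SchauderBasis 𝕜 X) {a : ℕ+ → 𝕜} (ha : ∀ i, a i ≠ 0)
    (F : Finset ℕ+) : supp b (∑ i ∈ F, a i • normalizedBasis b i) = F := by
  ext m
  simp [supp, coord_normalizedBasis, ha, b.linearIndependent.ne_zero]

theorem supp_smul (b : SchauderBasis 𝕜 X) {r : 𝕜} (hr : r ≠ 0) (y : X) :
    supp b (r • y) = supp b y := by
  ext m
  simp [supp, hr]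

theorem precedes_normalizedBasis (b : SchauderBasis 𝕜 X) (i j : ℕ+) (hij : i < j) :
    Precedes b (normalizedBasis b i) (normalizedBasis b j) := by
  have h : ∀ i, supp b (normalizedBasis b i) = {i} := fun i => by
    simpa using supp_sum_normalizedBasis b (a := fun _ => 1) (fun _ => one_ne_zero) {i}
  intro k hk l hl
  rw [h] at hk hl
  rwa [hk, hl]

theorem sum_eq_sum_orderEmbOfFin {M : Type*} [AddCommMonoid M] (A : Finset ℕ+) (f : ℕ+ → M) :
    ∑ j ∈ A, f j = ∑ t, f (A.orderEmbOfFin rfl t) := by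
  conv_lhs => rw [← Finset.map_orderEmbOfFin_univ A rfl]
  rw [Finset.sum_map]
  rfl

/-- The block sums `y j`, once normalized, are admissible; applying `hb` to them with coefficients
`‖y j‖` costs `C`, and the estimate inside each block costs `K`. -/
theorem comp_subset_l1Family {b : SchauderBasis 𝕜 X} {𝓐 : Set (Finset ℕ+)} {C K : ℝ} (hK : 0 ≤ K)
    (hb : ∀ (k : ℕ) (x : Fin k → X), (∀ i, ‖x i‖ = 1) →
      IsAdmissible 𝓐 (fun i => supp b (x i)) → IsL1Equiv 𝕜 C x) :
    comp 𝓐 (l1Family 𝕜 (normalizedBasis b) K) ⊆ l1Family 𝕜 (normalizedBasis b) (K * C) := by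
  rintro _ ⟨A, hA, G, hG, rfl⟩
  refine mem_l1Family_of_forall_ne_zero fun a ha => ?_
  have hdisj : (A : Set ℕ+).PairwiseDisjoint G := by
    intro i hi j hj hij
    refine Finset.disjoint_left.2 fun m hmi hmj => ?_
    rcases lt_or_gt_of_ne hij with hij | hij
    · exact lt_irrefl m (hG.lt i hi j hj hij m hmi m hmj)
    · exact lt_irrefl m (hG.lt j hj i hi hij m hmj m hmi)
  set y : ℕ+ → X := fun j => ∑ i ∈ G j, a i • normalizedBasis b i with hy
  have hsupp : ∀ j, supp b (y j) = G j := fun j => supp_sum_normalizedBasis b ha (G j)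
  have hy0 : ∀ j ∈ A, y j ≠ 0 := fun j hj h => by
    have hmem := (hG.isLeast j hj).1
    rw [← hsupp, h] at hmem
    simp [supp] at hmem
  have hr0 : ∀ j ∈ A, ((‖y j‖⁻¹ : ℝ) : 𝕜) ≠ 0 := fun j hj => by
    simpa using hy0 j hj
  set E := A.orderEmbOfFin rfl with hE
  have hEA : ∀ t, E t ∈ A := fun t => Finset.orderEmbOfFin_mem A rfl t
  have hsupp' : ∀ t, supp b (((‖y (E t)‖⁻¹ : ℝ) : 𝕜) • y (E t)) = G (E t) := fun t => by
    rw [supp_smul b (hr0 _ (hEA t)), hsupp]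
  have key := hb A.card (fun t => ((‖y (E t)‖⁻¹ : ℝ) : 𝕜) • y (E t)) (fun t => ?_) ?_
    (fun t => ((‖y (E t)‖ : ℝ) : 𝕜))
  · have hcancel : ∀ t, ((‖y (E t)‖ : ℝ) : 𝕜) • ((‖y (E t)‖⁻¹ : ℝ) : 𝕜) • y (E t) = y (E t) := by
      intro t
      rw [smul_smul, ← RCLike.ofReal_mul, mul_inv_cancel₀ (norm_ne_zero_iff.2 (hy0 _ (hEA t))),
        RCLike.ofReal_one, one_smul]
    simp only [hcancel, RCLike.norm_ofReal, abs_norm] at key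
    rw [← sum_eq_sum_orderEmbOfFin A y, ← sum_eq_sum_orderEmbOfFin A fun j => ‖y j‖] at key
    rw [Finset.sum_biUnion hdisj, Finset.sum_biUnion hdisj]
    calc ∑ j ∈ A, ∑ i ∈ G j, ‖a i‖ ≤ ∑ j ∈ A, K * ‖y j‖ :=
          Finset.sum_le_sum fun j hj => hG.mem j hj a
      _ = K * ∑ j ∈ A, ‖y j‖ := (Finset.mul_sum _ _ _).symm
      _ ≤ K * (C * ‖∑ j ∈ A, y j‖) := mul_le_mul_of_nonneg_left key hK
      _ = K * C * ‖∑ j ∈ A, y j‖ := (mul_assoc _ _ _).symm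
  · rw [norm_smul, RCLike.norm_ofReal, abs_of_nonneg (by positivity),
      inv_mul_cancel₀ (norm_ne_zero_iff.2 (hy0 _ (hEA t)))]
  · simp only [IsAdmissible, hsupp']
    refine ⟨fun s t hst => hG.lt _ (hEA s) _ (hEA t) (E.strictMono hst), E,
      fun t => hG.isLeast _ (hEA t), ?_⟩
    convert hA
    rw [← Finset.coe_inj]
    simp [hE]

theorem IsL1Asymptotic.exists_hasRank {b : SchauderBasis 𝕜 X}
    {c : Ordinal.{u} → ℕ+ → Ordinal.{u}} (hc : IsLadder c) {α : Ordinal.{u}} (hα : α < ω₁)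
    (h : IsL1Asymptotic b c α) (n : ℕ) :
    ∃ K : ℝ, 1 ≤ K ∧ HasRank (l1Family 𝕜 (normalizedBasis b) K) (ω ^ (α * n)) ∅ := by
  obtain ⟨C, hC, hb⟩ := h
  induction n with
  | zero =>
    -- Singletons suffice here, since only rank `ω ^ 0 = 1` is needed.
    refine ⟨1, le_rfl, (hasRank_schreier hc 0 ?_).mono ?_ |>.of_le (by simp)⟩
    · exact Ordinal.omega_pos 1
    · rw [schreier_zero]
      rintro F (hF | ⟨n, rfl⟩)
      · rw [Set.mem_singleton_iff.1 hF]
        intro a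
        simp
      · intro a
        simp [norm_smul, norm_normalizedBasis]
  | succ n ih =>
    obtain ⟨K, hK, hrank⟩ := ih
    refine ⟨K * C, one_le_mul_of_one_le_of_one_le hK hC, ?_⟩
    rw [Nat.cast_succ, mul_add_one, Ordinal.opow_add]
    exact ((hasRank_schreier hc α hα).comp hrank).mono
      (comp_subset_l1Family (zero_le_one.trans hK) hb)

theorem IsL1Asymptotic.opow_le_blockIndex {b : SchauderBasis 𝕜 X}
    {c : Ordinal.{u} → ℕ+ → Ordinal.{u}} (hc : IsLadder c) {α : Ordinal.{u}} (hα : α < ω₁)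
    (h : IsL1Asymptotic b c α) : ω ^ (α * ω) ≤ blockIndex b := by
  refine le_of_forall_lt fun δ hδ => ?_
  obtain ⟨n, hn⟩ : ∃ n : ℕ, δ < ω ^ (α * n) := by
    -- For `α = 0` the exponent `α * ω` is `0`, not a limit, and is treated apart.
    rcases eq_or_ne α 0 with rfl | h0
    · exact ⟨0, by simpa using hδ⟩
    · have hlim : Order.IsSuccLimit (α * ω) :=
        Ordinal.isSuccLimit_mul_right h0.bot_lt Ordinal.isSuccLimit_omega0
      obtain ⟨β, hβ, hδβ⟩ := (Ordinal.lt_opow_of_isSuccLimit Ordinal.omega0_ne_zero hlim).1 hδ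
      obtain ⟨γ, hγ, hβγ⟩ := (Ordinal.lt_mul_iff_of_isSuccLimit Ordinal.isSuccLimit_omega0).1 hβ
      obtain ⟨n, rfl⟩ := Ordinal.lt_omega0.1 hγ
      exact ⟨n, hδβ.trans_le (Ordinal.opow_le_opow_right Ordinal.omega0_pos hβγ.le)⟩
  obtain ⟨K, hK, hrank⟩ := h.exists_hasRank hc hα n
  obtain ⟨m, hm⟩ := (hrank.eventually hn).exists
  have hω : ω ^ (α * n) < ω₁ := by
    refine opow_lt_omega_one ?_
    exact Ordinal.isPrincipal_mul_omega 1 hα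
      ((Ordinal.natCast_lt_omega0 n).trans Ordinal.omega0_lt_omega_one)
  exact lt_blockIndex (norm_normalizedBasis b) (precedes_normalizedBasis b) hK (hn.trans hω)
    (by simpa using hm)

end Banach

end BlockIndex

end

theorem mainTheorem5 {𝕜 : Type v} [RCLike 𝕜] {X : Type u} [NormedAddCommGroup X]
    [NormedSpace 𝕜 X] [CompleteSpace X] (b : SchauderBasis 𝕜 X)
    (c : Ordinal.{u} → ℕ+ → Ordinal.{u}) (hc : BlockIndex.IsLadder c)
    (α : Ordinal.{u}) (hα : α < ω₁) :
    (BlockIndex.AdmitsL1SpreadingModel b c α → ω ^ α < BlockIndex.blockIndex b) ∧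
    (BlockIndex.IsL1Asymptotic b c α → ω ^ (α * ω) ≤ BlockIndex.blockIndex b) :=
  ⟨fun h => h.lt_blockIndex hc hα, fun h => h.opow_le_blockIndex hc hα⟩
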